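/- Let $\mathsf K$ be a field, $n,\delta_L,\delta_R\in\mathbb N$. The degree of a polynomial vector or matrix is the highest degree of its entries. Let $H\in \mathsf K(x)^{n\times n}$ be strictly proper (that is, $\lim_{x\to\infty}H(x)=0$: in each entry the numerator has smaller degree than the denominator) and defined at $x=0$, with power series expansion $F\in\mathsf K[[x]]^{n\times n}$ at $x=0$. Assume that $H$ admits a right factorization of degree $\delta_R$, i.e. $H=BA^{-1}$ with $A,B\in\mathsf K[x]^{n\times n}$ of degree at most $\delta_R$ and $\det A\neq 0$, and a left factorization of degree $\delta_L$, i.e. $H=T^{-1}S$ with $S,T\in\mathsf K[x]^{n\times n}$ of degree at most $\delta_L$ and $\det T\ne 0$. Let $N\in\mathsf K[x]^{2n\times 2n}$ be a minimal approximant basis of order $\sigma=\delta_L+\delta_R+1$ for $\begin{bmatrix}-I_n\\ F\end{bmatrix}$; that is, the rows of $N$ form a basis of the $\mathsf K[x]$-module $$\mathcal M=\Big\{v\in\mathsf K[x]^{1\times 2n} : v\begin{bmatrix}-I_n\\ F\end{bmatrix}\equiv 0 \bmod x^{\sigma}\Big\}$$ such that, if $\delta_1\le\dots\le\delta_{2n}$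 are the degrees of its rows in nondecreasing order and $d_1\le\dots\le d_{2n}$ are those of any other basis of $\mathcal M$, then $\delta_i\le d_i$ for all $i$. Then exactly $n$ rows of $N$ have degree at most $\delta_L$. These rows, listed in any order, form a matrix $[U\ \ V]\in\mathsf K[x]^{n\times 2n}$, with $U,V\in \mathsf K[x]^{n\times n}$, such that $\det V\ne0$ and $H=V^{-1}U$ is a left factorization of degree $\delta_L$; $V$ and $U$ are left coprime, i.e. every left gcd of $V$ and $U$ (every polynomial matrix $G$ of full column rank such that $[G\ \ 0]\,P=[V\ \ U]$ for some unimodular $P$) is unimodular; and $V$ is row-reduced, i.e. it has full row rank and so does its row leading matrix, the constant matrix whose $i$-th row consists of the coefficients of $x^{d_i}$ in the $i$-th row of $V$, where $d_i$ is the degree of that row. -/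

import Mathlib

open Polynomial

namespace PolyMat

section Basic

variable {K : Type*} [Field K]

/-- The degree of a polynomial vector: the highest degree of its entries. -/
def vecDegree {m : Type*} [Fintype m] (v : m → K[X]) : ℕ :=
  Finset.univ.sup fun j => (v j).natDegree

/-- The entries of the polynomial matrix `A` all have degree at most `δ`. -/
def DegreeLE {m n : Type*} (A : Matrix m n K[X]) (δ : ℕ) : Prop :=
  ∀ i j, (A i j).natDegree ≤ δ

/-- A polynomial matrix seen as a matrix of rational functions. -/
noncomputable def toRat {m n : Type*} (A : Matrix m n K[X]) : Matrix m n (RatFunc K) :=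
  A.map (algebraMap K[X] (RatFunc K))

/-- The row leading matrix: its `i`-th row holds the coefficients of `x ^ dᵢ` in the `i`-th row
of `A`, where `dᵢ` is the `i`-th row degree of `A`. -/
def rowLeadingMatrix {m n : Type*} [Fintype n] (A : Matrix m n K[X]) : Matrix m n K :=
  Matrix.of fun i j => (A i j).coeff (vecDegree (A.row i))

/-- A matrix of full row rank is row-reduced if its row leading matrix also has full row rank. -/
def IsRowReduced {m n : Type*} [Fintype n] (A : Matrix m n K[X]) : Prop :=
  LinearIndependent K[X] A.row ∧ LinearIndependent K (rowLeadingMatrix A).row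

/-- A polynomial matrix is unimodular if it is invertible over the polynomials. The two index types
may differ (they then have the same number of elements). -/
def IsUnimodular {m n : Type*} [Fintype m] [Fintype n] [DecidableEq m] [DecidableEq n]
    (A : Matrix m n K[X]) : Prop :=
  ∃ B : Matrix n m K[X], A * B = 1 ∧ B * A = 1

/-- `G` is a left gcd of `A` and `B`: it has full column rank and `[G 0] P = [A B]` for some
unimodular `P`, with `s` zero columns next to `G`. -/
def IsLeftGcd {n m : Type*} [Fintype n] [Fintype m] [DecidableEq n] [DecidableEq m] {r : ℕ}
    (A : Matrix n n K[X]) (B : Matrix n m K[X]) (G : Matrix n (Fin r) K[X]) : Prop :=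
  LinearIndependent K[X] G.col ∧
    ∃ (s : ℕ) (P : Matrix (Fin r ⊕ Fin s) (n ⊕ m) K[X]), IsUnimodular P ∧
      Matrix.fromCols G (0 : Matrix n (Fin s) K[X]) * P = Matrix.fromCols A B

/-- The non-singular matrix `A` is left coprime with `B`: every left gcd of the two is
unimodular. -/
def IsLeftCoprime {n m : Type*} [Fintype n] [Fintype m] [DecidableEq n] [DecidableEq m]
    (A : Matrix n n K[X]) (B : Matrix n m K[X]) : Prop :=
  A.det ≠ 0 ∧ ∀ (r : ℕ) (G : Matrix n (Fin r) K[X]), IsLeftGcd A B G → IsUnimodular G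

/-- `H = V⁻¹ U` is a left factorization of degree `δ`. -/
def IsLeftFactorization {n : ℕ} (H : Matrix (Fin n) (Fin n) (RatFunc K)) (δ : ℕ)
    (U V : Matrix (Fin n) (Fin n) K[X]) : Prop :=
  V.det ≠ 0 ∧ H = (toRat V)⁻¹ * toRat U ∧ DegreeLE U δ ∧ DegreeLE V δ

/-- `H = B A⁻¹` is a right factorization of degree `δ`. -/
def IsRightFactorization {n : ℕ} (H : Matrix (Fin n) (Fin n) (RatFunc K)) (δ : ℕ)
    (B A : Matrix (Fin n) (Fin n) K[X]) : Prop :=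
  A.det ≠ 0 ∧ H = toRat B * (toRat A)⁻¹ ∧ DegreeLE B δ ∧ DegreeLE A δ

/-- `H` tends to zero at infinity: in each entry the numerator has smaller degree than the
denominator (the zero polynomial has degree `⊥`). -/
def IsStrictlyProper {m n : Type*} (H : Matrix m n (RatFunc K)) : Prop :=
  ∀ i j, (H i j).num.degree < (H i j).denom.degree

/-- `F` is the power series expansion of `H` at `x = 0` (in particular `H` is defined there):
`H` and `F` agree in the field of Laurent series. -/
def IsExpansionAtZero {m n : Type*} (H : Matrix m n (RatFunc K)) (F : Matrix m n (PowerSeries K)) :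
    Prop :=
  ∀ i j, ((H i j : RatFunc K) : LaurentSeries K) = HahnSeries.ofPowerSeries ℤ K (F i j)

/-- The approximants of order `d` for `F`: the polynomial row vectors `v` with
`v F ≡ 0 mod x ^ d`. -/
noncomputable def approximants {m k : Type*} [Fintype m] (F : Matrix m k (PowerSeries K)) (d : ℕ) :
    Submodule K[X] (m → K[X]) where
  carrier := {v | ∀ j, (PowerSeries.X : PowerSeries K) ^ d ∣
    Matrix.vecMul (fun i => (v i : PowerSeries K)) F j}
  add_mem' := by
    intro a b ha hb j
    have h := dvd_add (ha j) (hb j)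
    simpa [Matrix.vecMul, dotProduct, add_mul, Finset.sum_add_distrib] using h
  zero_mem' := by
    intro j
    simp [Matrix.vecMul, dotProduct]
  smul_mem' := by
    intro c v hv j
    have h := Dvd.dvd.mul_left (hv j) (c : PowerSeries K)
    simpa [Matrix.vecMul, dotProduct, mul_assoc, Finset.mul_sum] using h

/-- The family `b` is a basis of the submodule `M`. -/
def IsBasisOf {m : Type*} {D : ℕ} (M : Submodule K[X] (m → K[X])) (b : Fin D → m → K[X]) : Prop :=
  LinearIndependent K[X] b ∧ Submodule.span K[X] (Set.range b) = M

/-- The degrees of the members of `b`, in nondecreasing order. -/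
def sortedDegrees {m : Type*} [Fintype m] {D : ℕ} (b : Fin D → m → K[X]) : Fin D → ℕ :=
  (fun i => vecDegree (b i)) ∘ Tuple.sort fun i => vecDegree (b i)

/-- `b` is a minimal basis of `M`: the sorted degrees of any other basis dominate those of `b`
one by one. The members of `b` may be listed in any order. -/
def IsMinimalBasis {m : Type*} [Fintype m] {D : ℕ} (M : Submodule K[X] (m → K[X]))
    (b : Fin D → m → K[X]) : Prop :=
  IsBasisOf M b ∧
    ∀ c : Fin D → m → K[X], IsBasisOf M c → ∀ i, sortedDegrees b i ≤ sortedDegrees c i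

/-- The rows of `N` form a minimal approximant basis for `F` of order `d`. -/
def IsMinimalApproximantBasis {m k : Type*} [Fintype m] {D : ℕ} (F : Matrix m k (PowerSeries K))
    (d : ℕ) (N : Matrix (Fin D) m K[X]) : Prop :=
  IsMinimalBasis (approximants F d) N.row

end Basic

end PolyMat

namespace PolyMat

/-! ### Minimal bases are row-reduced and have the predictable degree property -/

section ReducedBases

variable {K : Type*} [Field K] {m : Type*}

/-! Let `[u v]` be an approximant of degree at most `δL`. Multiplying `v F - u` by `A` gives `v B -
u A`, a polynomial of degree at most `δL + δR` divisible by a higher power of `x`. It therefore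
vanishes, and `u = v H` exactly (`vecMul_eq_of_mem_approximants`).

So `v` determines `u`, and the `V`-parts of the low-degree rows of `N` stay independent: there are
at most `n` such rows. Conversely, the rows of `[S T]` are `n` independent approximants of degree at
most `δL`. A minimal basis is row-reduced, so by predictable degrees they lie in the span of its
low-degree members, of which there are then at least `n` (`IsMinimalBasis.card_le`).

If `G` is a left gcd, then `[U V] = G [U' V']`, and cancelling `G` shows that `[U' V']` also solves
the equation exactly, so its rows lie in the module. Expanding them in the basis `N` makes `G` right
invertible (`isUnimodular_of_mul_mem`). Finally, strict properness forces `deg u < deg v` unless `u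
= 0`, so the leading matrix of `[U V]` is `[0 *]` and `V` inherits row-reducedness from `N`. -/

theorem natDegree_le_vecDegree [Fintype m] (v : m → K[X]) (j : m) : (v j).natDegree ≤ vecDegree v :=
  Finset.le_sup (f := fun j => (v j).natDegree) (Finset.mem_univ j)

theorem vecDegree_le_iff [Fintype m] {v : m → K[X]} {d : ℕ} :
    vecDegree v ≤ d ↔ ∀ j, (v j).natDegree ≤ d := by
  simp [vecDegree, Finset.sup_le_iff]

theorem vecDegree_lt_of_coeff_eq_zero [Fintype m] {v : m → K[X]} (hv : v ≠ 0) {d : ℕ} (h : vecDegree v ≤ d)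
    (h0 : ∀ j, (v j).coeff d = 0) : vecDegree v < d := by
  have hd : 0 < d := by
    rcases Nat.eq_zero_or_pos d with rfl | hd
    · refine absurd (funext fun j => ?_) hv
      have hj := vecDegree_le_iff.1 h j
      rw [eq_C_of_natDegree_le_zero hj, h0 j, C_0, Pi.zero_apply]
    · exact hd
  refine (Finset.sup_lt_iff (by simpa using hd)).2 fun j _ => ?_
  refine lt_of_le_of_ne (vecDegree_le_iff.1 h j) fun he => ?_
  have := h0 j
  rw [← he, coeff_natDegree, leadingCoeff_eq_zero] at this
  rw [this, natDegree_zero] at he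
  omega

/-- Elementary row operation: `b i` can be recovered from the new vector because `a i` is a unit. -/
theorem isBasisOf_update {D : ℕ} {M : Submodule K[X] (m → K[X])} {b : Fin D → m → K[X]}
    (hb : IsBasisOf M b) (i : Fin D) (a : Fin D → K[X]) (ha : IsUnit (a i)) :
    IsBasisOf M (Function.update b i (∑ j, a j • b j)) := by
  classical
  obtain ⟨hli, hsp⟩ := hb
  set c := Function.update b i (∑ j, a j • b j) with hc
  have hci : c i = ∑ j, a j • b j := by simp [hc]
  have hcj : ∀ j, j ≠ i → c j = b j := fun j hj => by simp [hc, hj]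
  refine ⟨?_, ?_⟩
  · rw [Fintype.linearIndependent_iff] at hli ⊢
    intro p hp
    have key : ∑ j, ((if j = i then 0 else p j) + p i * a j) • b j = 0 := by
      rw [← hp]
      simp_rw [add_smul, Finset.sum_add_distrib, mul_smul, ← Finset.smul_sum]
      rw [← hci, add_comm, ← Finset.add_sum_erase _ _ (Finset.mem_univ i),
        ← Finset.add_sum_erase _ (fun j => p j • c j) (Finset.mem_univ i)]
      simp only [if_true, zero_smul, zero_add]
      congr 1
      refine Finset.sum_congr rfl fun j hj => ?_
      rw [if_neg (Finset.ne_of_mem_erase hj), hcj j (Finset.ne_of_mem_erase hj)]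
    have h := hli _ key
    have hi : p i = 0 := by
      have := h i
      simp only [if_true, zero_add] at this
      exact (mul_eq_zero.1 this).resolve_right ha.ne_zero
    intro j
    by_cases hj : j = i
    · rw [hj, hi]
    · simpa [hj, hi] using h j
  · rw [← hsp]
    apply le_antisymm
    · rw [Submodule.span_le]
      rintro _ ⟨j, rfl⟩
      by_cases hj : j = i
      · subst hj
        rw [hci]
        exact Submodule.sum_mem _ fun k _ =>
          Submodule.smul_mem _ _ (Submodule.subset_span ⟨k, rfl⟩)
      · rw [hcj j hj]
        exact Submodule.subset_span ⟨j, rfl⟩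
    · rw [Submodule.span_le]
      rintro _ ⟨j, rfl⟩
      by_cases hj : j = i
      · subst hj
        have h1 : a j • b j = c j - ∑ k ∈ Finset.univ.erase j, a k • c k := by
          rw [hci, ← Finset.add_sum_erase _ _ (Finset.mem_univ j), eq_sub_iff_add_eq]
          congr 1
          exact Finset.sum_congr rfl fun k hk => by rw [hcj k (Finset.ne_of_mem_erase hk)]
        have h2 : a j • b j ∈ Submodule.span K[X] (Set.range c) := by
          rw [h1]
          exact Submodule.sub_mem _ (Submodule.subset_span ⟨j, rfl⟩) (Submodule.sum_mem _ fun k _ =>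
            Submodule.smul_mem _ _ (Submodule.subset_span ⟨k, rfl⟩))
        exact (Submodule.smul_mem_iff_of_isUnit _ ha).1 h2
      · rw [← hcj j hj]
        exact Submodule.subset_span ⟨j, rfl⟩

variable [Fintype m]

theorem sum_sortedDegrees {D : ℕ} (b : Fin D → m → K[X]) :
    ∑ i, sortedDegrees b i = ∑ i, vecDegree (b i) :=
  Equiv.sum_comp (Tuple.sort fun i => vecDegree (b i)) fun i => vecDegree (b i)

/-- The row leading matrix of a minimal basis has full row rank. -/
theorem IsMinimalBasis.linearIndependent_rowLeadingMatrix {D : ℕ} {M : Submodule K[X] (m → K[X])}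
    {b : Fin D → m → K[X]} (hb : IsMinimalBasis M b) :
    LinearIndependent K (rowLeadingMatrix (Matrix.of b)).row := by
  classical
  by_contra hdep
  obtain ⟨g, hg, i₁, hi₁⟩ := Fintype.not_linearIndependent_iff.1 hdep
  -- Replacing a member of largest degree in the dependency makes every shift exponent a true
  -- difference, and the coefficient of `b i` a nonzero constant.
  obtain ⟨i, hi, hmax⟩ := Finset.exists_max_image (Finset.univ.filter fun i => g i ≠ 0)
    (fun i => vecDegree (b i)) ⟨i₁, by simpa using hi₁⟩
  have hi : g i ≠ 0 := by simpa using hi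
  have hmax : ∀ j, g j ≠ 0 → vecDegree (b j) ≤ vecDegree (b i) := fun j hj =>
    hmax j (by simpa using hj)
  set a : Fin D → K[X] := fun j => C (g j) * X ^ (vecDegree (b i) - vecDegree (b j)) with ha
  have hai : a i = C (g i) := by simp [ha]
  have hc := isBasisOf_update hb.1 i a (by rw [hai]; exact isUnit_C.2 hi.isUnit)
  set v := ∑ j, a j • b j with hv
  have hterm : ∀ j l, (a j * b j l).natDegree ≤ vecDegree (b i) := by
    intro j l
    by_cases hj : g j = 0
    · simp [ha, hj]
    · have h1 := natDegree_C_mul_X_pow_le (g j) (vecDegree (b i) - vecDegree (b j))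
      have h2 := natDegree_le_vecDegree (b j) l
      have h3 := hmax j hj
      refine natDegree_mul_le.trans ?_
      simp only [ha]
      omega
  have hle : vecDegree v ≤ vecDegree (b i) := by
    refine vecDegree_le_iff.2 fun l => ?_
    simp only [hv, Finset.sum_apply, Pi.smul_apply, smul_eq_mul]
    exact natDegree_sum_le_of_forall_le _ _ fun j _ => hterm j l
  have hcoeff : ∀ l, (v l).coeff (vecDegree (b i)) = 0 := by
    intro l
    have hgl := congrFun hg l
    simp only [Finset.sum_apply, Pi.smul_apply, smul_eq_mul, Pi.zero_apply] at hgl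
    simp only [hv, Finset.sum_apply, Pi.smul_apply, smul_eq_mul, finsetSum_coeff]
    rw [← hgl]
    refine Finset.sum_congr rfl fun j _ => ?_
    by_cases hj : g j = 0
    · simp [ha, hj]
    · have h3 := hmax j hj
      simp only [ha, mul_assoc, coeff_C_mul, coeff_X_pow_mul']
      rw [if_pos (Nat.sub_le _ _), Nat.sub_sub_self h3]
      rfl
  have hv0 : v ≠ 0 := by
    have := hc.1.ne_zero i
    simpa using this
  have hlt := vecDegree_lt_of_coeff_eq_zero hv0 hle hcoeff
  -- Summing removes the sorting: the new basis has strictly smaller total degree, against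
  -- minimality.
  have hsum := Finset.sum_le_sum fun k (_ : k ∈ Finset.univ) => hb.2 _ hc k
  rw [sum_sortedDegrees, sum_sortedDegrees] at hsum
  refine absurd hsum (not_le.2 (Finset.sum_lt_sum (fun k _ => ?_) ⟨i, Finset.mem_univ i, ?_⟩))
  · by_cases hk : k = i
    · subst hk; simpa using hle
    · simp [hk]
  · simpa using hlt

/-- The predictable degree property of row-reduced families. -/
theorem natDegree_add_vecDegree_le {D : ℕ} {b : Fin D → m → K[X]}
    (hb : LinearIndependent K (rowLeadingMatrix (Matrix.of b)).row) (p : Fin D → K[X])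
    {i : Fin D} (hi : p i ≠ 0) :
    (p i).natDegree + vecDegree (b i) ≤ vecDegree (∑ j, p j • b j) := by
  classical
  obtain ⟨k, hk, hmax⟩ := Finset.exists_max_image (Finset.univ.filter fun i => p i ≠ 0)
    (fun i => (p i).natDegree + vecDegree (b i)) ⟨i, by simpa using hi⟩
  have hk : p k ≠ 0 := by simpa using hk
  have hmax : ∀ j, p j ≠ 0 →
      (p j).natDegree + vecDegree (b j) ≤ (p k).natDegree + vecDegree (b k) := fun j hj =>
    hmax j (by simpa using hj)
  refine (hmax i hi).trans (not_lt.1 fun hlt => ?_)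
  set e := (p k).natDegree + vecDegree (b k) with he
  -- If the degree dropped below `e`, the coefficients of `x ^ e` would be a relation between
  -- leading rows, with the leading coefficient of `p k` as its `k`-th entry.
  have hzero := Fintype.linearIndependent_iff.1 hb
    (fun j => if p j = 0 then 0 else (p j).coeff (e - vecDegree (b j))) ?_ k
  · simp [hk, he] at hzero
  · ext l
    simp only [Finset.sum_apply, Pi.smul_apply, smul_eq_mul, Pi.zero_apply]
    have h0 : ((∑ j, p j • b j) l).coeff e = 0 :=
      coeff_eq_zero_of_natDegree_lt ((natDegree_le_vecDegree _ l).trans_lt hlt)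
    simp only [Finset.sum_apply, Pi.smul_apply, smul_eq_mul, finsetSum_coeff] at h0
    refine (Finset.sum_congr rfl fun j _ => ?_).trans h0
    by_cases hj : p j = 0
    · simp [hj]
    · have h1 := hmax j hj
      have h2 : e = (e - vecDegree (b j)) + vecDegree (b j) := by omega
      conv_rhs => rw [h2]
      rw [if_neg hj, coeff_mul_add_eq_of_natDegree_le (by omega) (natDegree_le_vecDegree (b j) l)]
      rfl

/-- By predictable degrees, a basis member that really occurs in `v` cannot exceed `v` in degree. -/
theorem mem_span_of_vecDegree_le {D : ℕ} {M : Submodule K[X] (m → K[X])} {b : Fin D → m → K[X]}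
    (hb : IsMinimalBasis M b) {v : m → K[X]} (hv : v ∈ M) {d : ℕ} (hd : vecDegree v ≤ d) :
    v ∈ Submodule.span K[X] (Set.range fun i : {i // vecDegree (b i) ≤ d} => b i) := by
  rw [← hb.1.2, Submodule.mem_span_range_iff_exists_fun] at hv
  obtain ⟨p, rfl⟩ := hv
  refine Submodule.sum_mem _ fun i _ => ?_
  by_cases hi : p i = 0
  · simp [hi]
  · have h := natDegree_add_vecDegree_le hb.linearIndependent_rowLeadingMatrix p hi
    exact Submodule.smul_mem _ _ (Submodule.subset_span ⟨⟨i, by omega⟩, rfl⟩)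

end ReducedBases

/-! ### Transfer between rational functions and power series -/

section PowerSeriesExpansion

variable {K : Type*} [Field K]

/-- A polynomial matrix seen as a matrix of power series. -/
noncomputable def toSeries {m n : Type*} (A : Matrix m n K[X]) : Matrix m n (PowerSeries K) :=
  A.map (Polynomial.coeToPowerSeries.ringHom (R := K))

@[simp]
theorem toSeries_apply {m n : Type*} (A : Matrix m n K[X]) (i : m) (j : n) :
    toSeries A i j = (A i j : PowerSeries K) := rfl

theorem toSeries_mul {l m n : Type*} [Fintype m] (A : Matrix l m K[X]) (B : Matrix m n K[X]) :
    toSeries (A * B) = toSeries A * toSeries B :=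
  Matrix.map_mul

theorem toRat_mul {l m n : Type*} [Fintype m] (A : Matrix l m K[X]) (B : Matrix m n K[X]) :
    toRat (A * B) = toRat A * toRat B :=
  Matrix.map_mul

theorem det_toSeries {n : Type*} [Fintype n] [DecidableEq n] (A : Matrix n n K[X]) :
    (toSeries A).det = (A.det : PowerSeries K) :=
  (RingHom.map_det _ A).symm

theorem det_toRat {n : Type*} [Fintype n] [DecidableEq n] (A : Matrix n n K[X]) :
    (toRat A).det = algebraMap K[X] (RatFunc K) A.det :=
  (RingHom.map_det _ A).symm

theorem det_toSeries_ne_zero {n : Type*} [Fintype n] [DecidableEq n] {A : Matrix n n K[X]}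
    (hA : A.det ≠ 0) : (toSeries A).det ≠ 0 := by
  rw [det_toSeries]
  exact fun h => hA (Polynomial.coe_injective K (by simpa using h))

theorem isUnit_det_toRat {n : Type*} [Fintype n] [DecidableEq n] {A : Matrix n n K[X]}
    (hA : A.det ≠ 0) : IsUnit (toRat A).det := by
  rw [det_toRat, isUnit_iff_ne_zero]
  simpa using hA

theorem mul_right_cancel_of_linearIndependent_row {R l m n : Type*} [CommRing R] [Fintype m]
    {A : Matrix m n R} (hA : LinearIndependent R A.row) {P Q : Matrix l m R}
    (h : P * A = Q * A) : P = Q :=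
  funext fun i => Matrix.vecMul_injective_iff.2 hA (congrFun h i)

theorem mul_left_cancel_of_linearIndependent_col {R l m n : Type*} [CommRing R] [Fintype m]
    {A : Matrix l m R} (hA : LinearIndependent R A.col) {P Q : Matrix m n R}
    (h : A * P = A * Q) : P = Q := by
  ext i j
  exact congrFun (Matrix.mulVec_injective_iff.2 hA (congrFun (congrArg Matrix.transpose h) j)) i

theorem mul_right_cancel_of_det_ne_zero {R l n : Type*} [CommRing R] [IsDomain R] [Fintype n]
    [DecidableEq n] {A : Matrix n n R} (hA : A.det ≠ 0) {P Q : Matrix l n R}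
    (h : P * A = Q * A) : P = Q :=
  mul_right_cancel_of_linearIndependent_row (Matrix.linearIndependent_rows_of_det_ne_zero hA) h

theorem det_ne_zero_of_linearIndependent_row {R n : Type*} [CommRing R] [IsDomain R] [Fintype n]
    [DecidableEq n] {A : Matrix n n R} (hA : LinearIndependent R A.row) : A.det ≠ 0 := by
  intro h
  obtain ⟨v, hv, hv0⟩ := Matrix.exists_vecMul_eq_zero_iff.2 h
  exact hv (Matrix.vecMul_injective_iff.2 hA (hv0.trans (Matrix.zero_vecMul A).symm))

open scoped RatFunc

theorem IsExpansionAtZero.map_eq {m n : Type*} {H : Matrix m n (RatFunc K)}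
    {F : Matrix m n (PowerSeries K)} (hF : IsExpansionAtZero H F) :
    H.map (algebraMap (RatFunc K) (LaurentSeries K)) = F.map (HahnSeries.ofPowerSeries ℤ K) := by
  ext1 i j
  exact hF i j

theorem toRat_map {m n : Type*} (A : Matrix m n K[X]) :
    (toRat A).map (algebraMap (RatFunc K) (LaurentSeries K)) =
      (toSeries A).map (HahnSeries.ofPowerSeries ℤ K) := by
  ext1 i j
  exact (RatFunc.coe_coe (A i j)).symm

/-- Both sides are compared in the Laurent series, where rational functions and power series embed.
-/
theorem toRat_mul_eq_iff {l m n : Type*} [Fintype m] {H : Matrix m n (RatFunc K)}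
    {F : Matrix m n (PowerSeries K)} (hF : IsExpansionAtZero H F) {P : Matrix l m K[X]}
    {Q : Matrix l n K[X]} : toRat P * H = toRat Q ↔ toSeries P * F = toSeries Q := by
  rw [← (Matrix.map_injective (algebraMap (RatFunc K) (LaurentSeries K)).injective).eq_iff,
    ← (Matrix.map_injective (HahnSeries.ofPowerSeries_injective (Γ := ℤ) (R := K))).eq_iff,
    Matrix.map_mul, Matrix.map_mul, hF.map_eq, toRat_map, toRat_map]

theorem mul_toRat_eq_iff {l m n : Type*} [Fintype m] {H : Matrix l m (RatFunc K)}
    {F : Matrix l m (PowerSeries K)} (hF : IsExpansionAtZero H F) {P : Matrix m n K[X]}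
    {Q : Matrix l n K[X]} : H * toRat P = toRat Q ↔ F * toSeries P = toSeries Q := by
  rw [← (Matrix.map_injective (algebraMap (RatFunc K) (LaurentSeries K)).injective).eq_iff,
    ← (Matrix.map_injective (HahnSeries.ofPowerSeries_injective (Γ := ℤ) (R := K))).eq_iff,
    Matrix.map_mul, Matrix.map_mul, hF.map_eq, toRat_map, toRat_map]

theorem eq_zero_of_X_pow_dvd_coe {p : K[X]} {d : ℕ}
    (h : (PowerSeries.X : PowerSeries K) ^ d ∣ (p : PowerSeries K)) (hp : p.natDegree < d) :
    p = 0 := by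
  ext i
  by_cases hi : i < d
  · simpa using PowerSeries.X_pow_dvd_iff.1 h i hi
  · simpa using coeff_eq_zero_of_natDegree_lt (by omega)

end PowerSeriesExpansion

/-! ### Low-degree approximants are exact solutions -/

section Approximants

variable {K : Type*} [Field K] {l m n : Type*} [Fintype m] [Fintype n] [DecidableEq n]

theorem mem_approximants_fromRows_iff {F : Matrix m n (PowerSeries K)} {d : ℕ}
    {v : n ⊕ m → K[X]} :
    v ∈ approximants (Matrix.fromRows (-1 : Matrix n n (PowerSeries K)) F) d ↔
      ∀ j, (PowerSeries.X : PowerSeries K) ^ d ∣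
        ∑ k, (v (Sum.inr k) : PowerSeries K) * F k j - (v (Sum.inl j) : PowerSeries K) := by
  refine forall_congr' fun j => ?_
  simp [Matrix.vecMul, dotProduct, Matrix.one_apply, neg_add_eq_sub]

theorem row_fromCols_mem_approximants {F : Matrix m n (PowerSeries K)} {U : Matrix l n K[X]}
    {V : Matrix l m K[X]} (h : toSeries V * F = toSeries U) (d : ℕ) (i : l) :
    (Matrix.fromCols U V).row i ∈
      approximants (Matrix.fromRows (-1 : Matrix n n (PowerSeries K)) F) d := by
  refine mem_approximants_fromRows_iff.2 fun j => ?_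
  have := congrFun (congrFun h i) j
  simp only [Matrix.mul_apply, toSeries_apply] at this
  simp [this]

/-- An approximant of low degree solves the key equation exactly. -/
theorem vecMul_eq_of_mem_approximants {F : Matrix m n (PowerSeries K)} {A : Matrix n n K[X]}
    {B : Matrix m n K[X]} (hFA : F * toSeries A = toSeries B) {δL δR : ℕ} (hA : DegreeLE A δR)
    (hB : DegreeLE B δR) {v : n ⊕ m → K[X]}
    (hv : v ∈ approximants (Matrix.fromRows (-1 : Matrix n n (PowerSeries K)) F) (δL + δR + 1))
    (hd : vecDegree v ≤ δL) :
    Matrix.vecMul (v ∘ Sum.inr) B = Matrix.vecMul (v ∘ Sum.inl) A := by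
  rw [mem_approximants_fromRows_iff] at hv
  rw [vecDegree_le_iff] at hd
  funext j
  rw [← sub_eq_zero]
  refine eq_zero_of_X_pow_dvd_coe (d := δL + δR + 1) ?_ ?_
  · have h : ((Matrix.vecMul (v ∘ Sum.inr) B j - Matrix.vecMul (v ∘ Sum.inl) A j : K[X]) :
        PowerSeries K) = ∑ i, (∑ k, (v (Sum.inr k) : PowerSeries K) * F k i -
          (v (Sum.inl i) : PowerSeries K)) * (A i j : PowerSeries K) := by
      have hB' : ∀ k, (B k j : PowerSeries K) = ∑ i, F k i * (A i j : PowerSeries K) := fun k =>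
        (congrFun (congrFun hFA k) j).symm
      simp_rw [sub_mul, Finset.sum_sub_distrib, Finset.sum_mul]
      rw [Finset.sum_comm]
      simp_rw [mul_assoc, ← Finset.mul_sum, ← hB']
      simp only [Matrix.vecMul, dotProduct, ← Polynomial.coeToPowerSeries.ringHom_apply, map_sub,
        map_sum, map_mul, Function.comp]
    rw [h]
    exact Finset.dvd_sum fun i _ => Dvd.dvd.mul_right (hv i) _
  -- The degree is at most `δL + δR`, one less than the order.
  · refine Nat.lt_succ_of_le ((natDegree_sub_le _ _).trans (max_le ?_ ?_))
    · exact natDegree_sum_le_of_forall_le _ _ fun k _ =>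
        natDegree_mul_le.trans (add_le_add (hd _) (hB k j))
    · exact natDegree_sum_le_of_forall_le _ _ fun k _ =>
        natDegree_mul_le.trans (add_le_add (hd _) (hA k j))

end Approximants

/-! ### Strict properness through the valuation at infinity -/

section StrictlyProper

variable {K : Type*} [Field K]

theorem inftyValuation_polynomial [DecidableEq (RatFunc K)] {p : K[X]} (hp : p ≠ 0) :
    RatFunc.inftyValuation K (algebraMap K[X] (RatFunc K) p) = WithZero.exp (p.natDegree : ℤ) :=
  RatFunc.inftyValuation.polynomial K hp

open WithZero in
theorem inftyValuation_lt_one [DecidableEq (RatFunc K)] {r : RatFunc K} (h : r.num.degree < r.denom.degree) :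
    RatFunc.inftyValuation K r < 1 := by
  by_cases hr : r = 0
  · simp [hr]
  · rw [RatFunc.inftyValuation_apply, RatFunc.inftyValuation_of_nonzero K hr, ← exp_zero, exp_lt_exp]
    have := natDegree_lt_natDegree (RatFunc.num_ne_zero hr) h
    rw [RatFunc.intDegree]
    omega

open WithZero in
/-- If `w H = u` for a strictly proper column `H`, then `u` has smaller degree than `w`. -/
theorem eq_zero_or_natDegree_lt {m : Type*} [Fintype m] {w : m → K[X]} {H : m → RatFunc K}
    (hH : ∀ k, (H k).num.degree < (H k).denom.degree) {u : K[X]}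
    (h : ∑ k, algebraMap K[X] (RatFunc K) (w k) * H k = algebraMap K[X] (RatFunc K) u) :
    u = 0 ∨ u.natDegree < vecDegree w := by
  classical
  refine or_iff_not_imp_left.2 fun hu => ?_
  have hlt : RatFunc.inftyValuation K (∑ k, algebraMap K[X] (RatFunc K) (w k) * H k) <
      exp (vecDegree w : ℤ) := by
    -- Ultrametric inequality: it suffices to bound each term.
    refine Valuation.map_sum_lt _ exp_ne_zero fun k _ => ?_
    rw [map_mul]
    by_cases hw : w k = 0
    · simp [hw]
    · rw [inftyValuation_polynomial hw]
      have hle : exp ((w k).natDegree : ℤ) ≤ exp (vecDegree w : ℤ) :=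
        exp_le_exp.2 (by exact_mod_cast natDegree_le_vecDegree w k)
      calc exp ((w k).natDegree : ℤ) * RatFunc.inftyValuation K (H k)
          < exp ((w k).natDegree : ℤ) * 1 :=
            mul_lt_mul_of_pos_left (inftyValuation_lt_one (hH k)) exp_pos
        _ ≤ _ := by rwa [mul_one]
  rw [h, inftyValuation_polynomial hu, exp_lt_exp] at hlt
  exact_mod_cast hlt

/-- A strictly proper left quotient does not contribute to the row leading matrix. -/
theorem rowLeadingMatrix_fromCols {l m n : Type*} [Fintype m] [Fintype n]
    {H : Matrix m n (RatFunc K)} (hH : IsStrictlyProper H) {U : Matrix l n K[X]}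
    {V : Matrix l m K[X]} (h : toRat V * H = toRat U) :
    rowLeadingMatrix (Matrix.fromCols U V) =
      Matrix.fromCols (0 : Matrix l n K) (rowLeadingMatrix V) := by
  have hU : ∀ i j, U i j = 0 ∨ (U i j).natDegree < vecDegree (V.row i) := fun i j =>
    eq_zero_or_natDegree_lt (H := fun k => H k j) (fun k => hH k j) (congrFun (congrFun h i) j)
  have hdeg : ∀ i, vecDegree ((Matrix.fromCols U V).row i) = vecDegree (V.row i) := by
    intro i
    refine le_antisymm (vecDegree_le_iff.2 ?_) (vecDegree_le_iff.2 fun j =>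
      natDegree_le_vecDegree ((Matrix.fromCols U V).row i) (Sum.inr j))
    rintro (j | j)
    · rcases hU i j with h0 | h0
      · simp [Matrix.row, h0]
      · exact h0.le
    · exact natDegree_le_vecDegree (V.row i) j
  ext i (j | j)
  · simp only [rowLeadingMatrix, Matrix.of_apply, hdeg, Matrix.fromCols_apply_inl,
      Matrix.zero_apply]
    rcases hU i j with h0 | h0
    · simp [h0]
    · exact coeff_eq_zero_of_natDegree_lt h0
  · simp [rowLeadingMatrix, hdeg]

end StrictlyProper

/-! ### Counting the low-degree rows, and coprimeness -/

section LowDegreeRows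

variable {K : Type*} [Field K]

theorem linearIndependent_row_fromCols_of_right {R l m n : Type*} [CommRing R] [Fintype l]
    {U : Matrix l n R} {V : Matrix l m R} (hV : LinearIndependent R V.row) :
    LinearIndependent R (Matrix.fromCols U V).row := by
  rw [← Matrix.vecMul_injective_iff] at hV ⊢
  intro p q h
  refine hV (funext fun j => ?_)
  exact congrFun h (Sum.inr j)

/-- If `U A = V B` with `A` non-singular, the rows of `V` are independent as soon as those of
`[U V]` are. -/
theorem linearIndependent_row_of_fromCols {R l m n : Type*} [CommRing R] [IsDomain R] [Fintype l]
    [Fintype m] [Fintype n] [DecidableEq n] {U : Matrix l n R} {V : Matrix l m R}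
    {A : Matrix n n R} {B : Matrix m n R} (hA : A.det ≠ 0) (h : V * B = U * A)
    (hUV : LinearIndependent R (Matrix.fromCols U V).row) : LinearIndependent R V.row := by
  rw [← Matrix.vecMul_injective_iff] at hUV ⊢
  intro p q hpq
  have hpq : Matrix.vecMul p V = Matrix.vecMul q V := hpq
  have hU : Matrix.vecMul p U = Matrix.vecMul q U := by
    refine Matrix.vecMul_injective_iff.2 (Matrix.linearIndependent_rows_of_det_ne_zero hA) ?_
    simp only [Matrix.vecMul_vecMul, ← h]
    rw [← Matrix.vecMul_vecMul, hpq, Matrix.vecMul_vecMul]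
  refine hUV ?_
  simp only [Matrix.vecMul_fromCols, hU, hpq]

theorem mul_eq_mul_of_mem_approximants {l m n : Type*} [Fintype m] [Fintype n] [DecidableEq n]
    {F : Matrix m n (PowerSeries K)} {A : Matrix n n K[X]} {B : Matrix m n K[X]}
    (hFA : F * toSeries A = toSeries B) {δL δR : ℕ} (hA : DegreeLE A δR) (hB : DegreeLE B δR)
    {U : Matrix l n K[X]} {V : Matrix l m K[X]}
    (hmem : ∀ i, (Matrix.fromCols U V).row i ∈
      approximants (Matrix.fromRows (-1 : Matrix n n (PowerSeries K)) F) (δL + δR + 1))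
    (hdeg : ∀ i, vecDegree ((Matrix.fromCols U V).row i) ≤ δL) : V * B = U * A := by
  ext1 i j
  have h := congrFun (vecMul_eq_of_mem_approximants hFA hA hB (hmem i) (hdeg i)) j
  simpa only [Matrix.vecMul, dotProduct, Function.comp, Matrix.row, Matrix.fromCols_apply_inl,
    Matrix.fromCols_apply_inr, Matrix.mul_apply] using h

/-- A minimal basis has at least as many members of degree at most `δ` as there are independent
vectors of degree at most `δ` in the module. -/
theorem IsMinimalBasis.card_le {m ι : Type*} [Fintype m] [Fintype ι] {D : ℕ}
    {M : Submodule K[X] (m → K[X])} {b : Fin D → m → K[X]} (hb : IsMinimalBasis M b) {δ : ℕ}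
    {v : ι → m → K[X]} (hv : LinearIndependent K[X] v) (hmem : ∀ i, v i ∈ M)
    (hdeg : ∀ i, vecDegree (v i) ≤ δ) :
    Fintype.card ι ≤ Fintype.card {i // vecDegree (b i) ≤ δ} := by
  classical
  have hinj : Function.Injective fun i : {i // vecDegree (b i) ≤ δ} => b i :=
    hb.1.1.injective.comp Subtype.val_injective
  have h := linearIndependent_le_span' v hv
    (Set.range fun i : {i // vecDegree (b i) ≤ δ} => b i) (by
      rintro _ ⟨i, rfl⟩
      exact mem_span_of_vecDegree_le hb (hmem i) (hdeg i))
  rw [Cardinal.mk_fintype, Nat.cast_le, Set.card_range_of_injective hinj] at h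
  exact h

/-- A selection of rows of a basis of the approximants cannot have a non-unimodular left divisor
which divides it within the approximants. -/
theorem isUnimodular_of_mul_mem {m : Type*} {D n r : ℕ} {M : Submodule K[X] (m → K[X])}
    {N : Matrix (Fin D) m K[X]} (hN : IsBasisOf M N.row) {f : Fin n → Fin D}
    (hf : Function.Injective f) {G : Matrix (Fin n) (Fin r) K[X]}
    (hG : LinearIndependent K[X] G.col) {Q : Matrix (Fin r) m K[X]} (hQ : ∀ k, Q.row k ∈ M)
    (hGQ : G * Q = N.submatrix f id) : IsUnimodular G := by
  have hspan : ∀ k, ∃ p : Fin D → K[X], ∑ i, p i • N.row i = Q.row k := fun k => by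
    rw [← Submodule.mem_span_range_iff_exists_fun, hN.2]
    exact hQ k
  choose W hW using hspan
  have hWN : Matrix.of W * N = Q := by
    ext1 k j
    simpa [Matrix.mul_apply, Finset.sum_apply] using congrFun (hW k) j
  -- After right multiplication by `N`, both sides are the selected rows of `N`, whose rows are
  -- independent.
  have hGW : G * Matrix.of W = (1 : Matrix (Fin D) (Fin D) K[X]).submatrix f id := by
    refine mul_right_cancel_of_linearIndependent_row hN.1 ?_
    rw [Matrix.mul_assoc, hWN, hGQ]
    ext1 i j
    simp [Matrix.mul_apply, Matrix.one_apply]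
  have h1 : G * (Matrix.of W).submatrix id f = 1 := by
    have := congrArg (fun Z => Z.submatrix id f) hGW
    ext1 i j
    simpa [Matrix.mul_apply, Matrix.one_apply, hf.eq_iff] using congrFun (congrFun this i) j
  -- `r = n` is not known here; the right inverse is also a left inverse because the independent
  -- columns of `G` allow left cancellation.
  refine ⟨_, h1, mul_left_cancel_of_linearIndependent_col hG ?_⟩
  rw [← Matrix.mul_assoc, h1, Matrix.one_mul, Matrix.mul_one]

/-- Rows of an approximant basis that describe `H = V⁻¹ U` form left coprime matrices. -/
theorem isLeftCoprime_of_isBasisOf {n D d : ℕ} {F : Matrix (Fin n) (Fin n) (PowerSeries K)}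
    {A B U V : Matrix (Fin n) (Fin n) K[X]} (hA : A.det ≠ 0) (hFA : F * toSeries A = toSeries B)
    (hV : V.det ≠ 0) (hVB : V * B = U * A) {N : Matrix (Fin D) (Fin n ⊕ Fin n) K[X]}
    (hN : IsBasisOf (approximants (Matrix.fromRows (-1 : Matrix _ _ (PowerSeries K)) F) d) N.row)
    {f : Fin n → Fin D} (hf : Function.Injective f)
    (hUV : Matrix.fromCols U V = N.submatrix f id) : IsLeftCoprime V U := by
  refine ⟨hV, fun r G ⟨hG, s, P, _, hP⟩ => ?_⟩
  have hGV : G * P.toRows₁.toCols₁ = V := by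
    ext1 i j
    simpa [Matrix.mul_apply] using congrFun (congrFun hP i) (Sum.inl j)
  have hGU : G * P.toRows₁.toCols₂ = U := by
    ext1 i j
    simpa [Matrix.mul_apply] using congrFun (congrFun hP i) (Sum.inr j)
  have hPB : P.toRows₁.toCols₁ * B = P.toRows₁.toCols₂ * A := by
    refine mul_left_cancel_of_linearIndependent_col hG ?_
    rw [← Matrix.mul_assoc, ← Matrix.mul_assoc, hGV, hGU, hVB]
  have hPF : toSeries P.toRows₁.toCols₁ * F = toSeries P.toRows₁.toCols₂ := by
    refine mul_right_cancel_of_det_ne_zero (det_toSeries_ne_zero hA) ?_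
    rw [Matrix.mul_assoc, hFA, ← toSeries_mul, ← toSeries_mul, hPB]
  refine isUnimodular_of_mul_mem hN hf hG (Q := Matrix.fromCols P.toRows₁.toCols₂ P.toRows₁.toCols₁)
    (row_fromCols_mem_approximants hPF d) ?_
  rw [Matrix.mul_fromCols, hGV, hGU, hUV]

end LowDegreeRows

end PolyMat

theorem theorem6 {K : Type*} [Field K] (n δL δR : ℕ)
    (H : Matrix (Fin n) (Fin n) (RatFunc K)) (hH : PolyMat.IsStrictlyProper H)
    (F : Matrix (Fin n) (Fin n) (PowerSeries K)) (hF : PolyMat.IsExpansionAtZero H F)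
    (hR : ∃ B A : Matrix (Fin n) (Fin n) (Polynomial K), PolyMat.IsRightFactorization H δR B A)
    (hL : ∃ S T : Matrix (Fin n) (Fin n) (Polynomial K), PolyMat.IsLeftFactorization H δL S T)
    (N : Matrix (Fin (2 * n)) (Fin n ⊕ Fin n) (Polynomial K))
    (hN : PolyMat.IsMinimalApproximantBasis
      (Matrix.fromRows (-1 : Matrix (Fin n) (Fin n) (PowerSeries K)) F) (δL + δR + 1) N) :
    Nat.card {i : Fin (2 * n) // PolyMat.vecDegree (N.row i) ≤ δL} = n ∧
    ∀ e : Fin n ≃ {i : Fin (2 * n) // PolyMat.vecDegree (N.row i) ≤ δL},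
      ∀ U V : Matrix (Fin n) (Fin n) (Polynomial K),
        Matrix.fromCols U V = N.submatrix (fun k => (e k : Fin (2 * n))) id →
          PolyMat.IsLeftFactorization H δL U V ∧
          PolyMat.IsLeftCoprime V U ∧
          PolyMat.IsRowReduced V := by
  open PolyMat in
  obtain ⟨B, A, hA, hHA, hBdeg, hAdeg⟩ := hR
  obtain ⟨S, T, hT, hHT, hSdeg, hTdeg⟩ := hL
  have hHA : H * toRat A = toRat B := by
    rw [hHA, Matrix.nonsing_inv_mul_cancel_right _ _ (isUnit_det_toRat hA)]
  have hFA := (mul_toRat_eq_iff hF).1 hHA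
  have hTH : toRat T * H = toRat S := by
    rw [hHT, Matrix.mul_nonsing_inv_cancel_left _ _ (isUnit_det_toRat hT)]
  have hTF := (toRat_mul_eq_iff hF).1 hTH
  have hmem : ∀ i, N.row i ∈ approximants
      (Matrix.fromRows (-1 : Matrix (Fin n) (Fin n) (PowerSeries K)) F) (δL + δR + 1) := fun i => by
    rw [← hN.1.2]
    exact Submodule.subset_span ⟨i, rfl⟩
  -- The index type is arbitrary because this also serves to bound the number of low-degree rows,
  -- before it is known to be `n`.
  have key : ∀ {l : Type} [Fintype l] (f : l → Fin (2 * n)), Function.Injective f →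
      (∀ i, vecDegree (N.row (f i)) ≤ δL) → ∀ U V : Matrix l (Fin n) (Polynomial K),
      Matrix.fromCols U V = N.submatrix f id →
      V * B = U * A ∧ LinearIndependent (Polynomial K) V.row := by
    intro l _ f hf hdeg U V hUV
    have hrow : ∀ i, (Matrix.fromCols U V).row i = N.row (f i) := fun i => by rw [hUV]; rfl
    have hVB := mul_eq_mul_of_mem_approximants hFA hAdeg hBdeg (U := U) (V := V)
      (fun i => by rw [hrow]; exact hmem (f i)) (fun i => by rw [hrow]; exact hdeg i)
    refine ⟨hVB, linearIndependent_row_of_fromCols hA hVB ?_⟩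
    rw [funext hrow]
    exact hN.1.1.comp f hf
  refine ⟨?_, fun e U V hUV => ?_⟩
  · rw [Nat.card_eq_fintype_card]
    apply le_antisymm
    · have h := (key (Subtype.val : {i // vecDegree (N.row i) ≤ δL} → Fin (2 * n))
        Subtype.val_injective (fun i => i.2) (N.submatrix Subtype.val id).toCols₁
        (N.submatrix Subtype.val id).toCols₂ (Matrix.fromCols_toCols _)).2
      simpa using h.fintype_card_le_finrank
    · have h := hN.card_le (δ := δL) (linearIndependent_row_fromCols_of_right (U := S)
        (Matrix.linearIndependent_rows_of_det_ne_zero hT))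
        (row_fromCols_mem_approximants hTF _) (fun i => vecDegree_le_iff.2 (by
          rintro (j | j)
          · exact hSdeg i j
          · exact hTdeg i j))
      simpa using h
  · have hf : Function.Injective fun k => (e k : Fin (2 * n)) :=
      Subtype.val_injective.comp e.injective
    obtain ⟨hVB, hV⟩ := key _ hf (fun i => (e i).2) U V hUV
    have hVdet := det_ne_zero_of_linearIndependent_row hV
    have hrow : ∀ i, (Matrix.fromCols U V).row i = N.row (e i) := fun i => by rw [hUV]; rfl
    have hVH : toRat V * H = toRat U := by
      refine mul_right_cancel_of_det_ne_zero (isUnit_det_toRat hA).ne_zero ?_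
      rw [Matrix.mul_assoc, hHA, ← toRat_mul, ← toRat_mul, hVB]
    have hdeg : ∀ i j, (Matrix.fromCols U V i j).natDegree ≤ δL := fun i =>
      vecDegree_le_iff.1 (show vecDegree ((Matrix.fromCols U V).row i) ≤ δL by
        rw [hrow]; exact (e i).2)
    refine ⟨⟨hVdet, ?_, fun i j => hdeg i (Sum.inl j), fun i j => hdeg i (Sum.inr j)⟩,
      isLeftCoprime_of_isBasisOf hA hFA hVdet hVB hN.1 hf hUV, hV, ?_⟩
    · rw [← hVH, Matrix.nonsing_inv_mul_cancel_left _ _ (isUnit_det_toRat hVdet)]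
    · have h := hN.linearIndependent_rowLeadingMatrix.comp _ hf
      have heq : (rowLeadingMatrix (Matrix.fromCols U V)).row =
          (rowLeadingMatrix (Matrix.of N.row)).row ∘ fun k => (e k : Fin (2 * n)) := by
        rw [hUV]; rfl
      -- The zero block left by `U` contributes nothing to independence.
      rw [← heq, rowLeadingMatrix_fromCols hH hVH] at h
      rw [← Matrix.vecMul_injective_iff] at h ⊢
      intro p q hpq
      have hpq : Matrix.vecMul p (rowLeadingMatrix V) = Matrix.vecMul q (rowLeadingMatrix V) := hpq
      refine h ?_
      simp only [Matrix.vecMul_fromCols, hpq, Matrix.vecMul_zero]
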